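/- Let $n\ge 0$ be an integer and $p\in[0,1]$. Let $G\sim\vec{G}(n,p)$ be the random simple digraph on $n$ labelled vertices in which each of the $n(n-1)$ directed edges $(i,j)$, $i\ne j$, is included independently with probability $p$ (so double edges $(i,j),(j,i)$ are allowed, loops are not). Let $\beta_1(G)$ be the first Betti number of the non-regular path homology of $G$ with integer coefficients. That is, let $\Lambda_k$ be the free $\mathbb{Z}$-module on all sequences $v_0\cdots v_k$ of vertices, with boundary $\partial_k e_{v_0\cdots v_k}=\sum_{i=0}^k(-1)^i e_{v_0\cdots\hat v_i\cdots v_k}$; let $\mathcal{A}_k\subseteq\Lambda_k$ be spanned by the sequences with $(v_i,v_{i+1})\in E(G)$ for all $i$; put $\Omega_k=\{x\in\mathcal{A}_k : \partial_k x\in\mathcal{A}_{k-1}\}$; then $\beta_1(G)$ is the rank of $\ker(\partial_1|_{\Omega_1})/\partial_2(\Omega_2)$. Then $$ \begin{aligned} \mathbb{P}(\beta_1(G)>0)\le{}& \binom{n}{4}4!\sum_{m=0}^{3}p^3(1-p)^{c_m}\Bigl(1-\sum_{l=0}^{8}q_{m,l}\,p^l(1-p)^{8-l}\Bigr)^{n-4}\\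 &+\binom{n}{2}p^2\,[1-p^2]^{2n-4}+2\binom{n}{3}p^3\,[1-p^3]^{2n-6}, \end{aligned} $$ where $(c_0,c_1,c_2,c_3)=(2,4,4,4)$ and $$ Q=(q_{m,l})_{0\le m\le 3,\ 0\le l\le 8}=\begin{pmatrix} 0&0&0&2&11&22&23&8&1\\ 0&0&0&4&19&33&25&8&1\\ 0&0&0&4&19&33&25&8&1\\ 0&0&0&2&16&34&26&8&1 \end{pmatrix}. $$ Here $0^0=1$, and a term whose binomial coefficient vanishes is read as $0$. -/

import Mathlib

open MeasureTheory ProbabilityTheory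

noncomputable section

namespace PathHomology

/-! ### Non-regular path homology of a digraph -/

/-- The free `R`-module on all sequences of `m` vertices. The module `Λ_p` of elementary `p`-paths
`v₀ ⋯ v_p` is `ElemPaths R V (p + 1)`; for `m = 0` there is exactly one (empty) sequence,
so `ElemPaths R V 0` is `Λ_{-1} = R`. -/
abbrev ElemPaths (R V : Type*) [CommRing R] (m : ℕ) : Type _ := (Fin m → V) →₀ R

/-- The non-regular boundary map `∂ e_{v₀ ⋯ v_m} = ∑ i, (-1)^i e_{v₀ ⋯ v̂ᵢ ⋯ v_m}`.
On a single vertex it is the augmentation. -/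
def boundary (R V : Type*) [CommRing R] (m : ℕ) :
    ElemPaths R V (m + 1) →ₗ[R] ElemPaths R V m :=
  Finsupp.linearCombination R fun v : Fin (m + 1) → V =>
    ∑ i : Fin (m + 1), Finsupp.single (fun j => v (i.succAbove j)) ((-1 : R) ^ (i : ℕ))

/-- A sequence of vertices is allowed if consecutive vertices are joined by a directed edge. -/
def IsAllowed {V : Type*} (G : Digraph V) {m : ℕ} (v : Fin m → V) : Prop :=
  ∀ i j : Fin m, (j : ℕ) = (i : ℕ) + 1 → G.Adj (v i) (v j)

/-- The submodule freely generated by the allowed sequences of `m` vertices. -/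
def allowedPaths (R : Type*) [CommRing R] {V : Type*} (G : Digraph V) (m : ℕ) :
    Submodule R (ElemPaths R V m) :=
  Finsupp.supported R R {v | IsAllowed G v}

/-- The module `Ω_p` of `∂`-invariant `p`-paths: allowed `p`-paths with allowed boundary. -/
def invariantPaths (R : Type*) [CommRing R] {V : Type*} (G : Digraph V) (p : ℕ) :
    Submodule R (ElemPaths R V (p + 1)) :=
  allowedPaths R G (p + 1) ⊓ (allowedPaths R G p).comap (boundary R V p)

/-- The kernel of `∂_p` on `Ω_p`. -/
def cycles (R : Type*) [CommRing R] {V : Type*} (G : Digraph V) (p : ℕ) :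
    Submodule R (ElemPaths R V (p + 1)) :=
  invariantPaths R G p ⊓ LinearMap.ker (boundary R V p)

/-- The image of `∂_{p+1}` on `Ω_{p+1}`. -/
def boundaries (R : Type*) [CommRing R] {V : Type*} (G : Digraph V) (p : ℕ) :
    Submodule R (ElemPaths R V (p + 1)) :=
  (invariantPaths R G (p + 1)).map (boundary R V (p + 1))

theorem boundary_boundary (R V : Type*) [CommRing R] (m : ℕ) (x : ElemPaths R V (m + 2)) :
    boundary R V m (boundary R V (m + 1) x) = 0 := by
  suffices h : (boundary R V m) ∘ₗ (boundary R V (m + 1)) = 0 from LinearMap.congr_fun h x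
  ext1 v
  apply LinearMap.ext_ring
  simp only [boundary, LinearMap.comp_apply, Finsupp.lsingle_apply,
    Finsupp.linearCombination_single, one_smul, map_sum, Finset.smul_sum, Finsupp.smul_single,
    smul_eq_mul, LinearMap.zero_comp, LinearMap.zero_apply]
  rw [← Fintype.sum_prod_type' (f := fun (i : Fin (m + 2)) (j : Fin (m + 1)) =>
    Finsupp.single (fun k => v (i.succAbove (j.succAbove k)))
      ((-1 : R) ^ (i : ℕ) * (-1 : R) ^ (j : ℕ)))]
  refine Finset.sum_involution (fun a _ => (a.1.succAbove a.2, a.2.predAbove a.1)) ?_ ?_ ?_ ?_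
  · rintro ⟨i, j⟩ -
    have h := Fin.neg_one_pow_succAbove_add_predAbove (R := R) i j
    simp only [← pow_add, h, Fin.succAbove_succAbove_succAbove_predAbove, ← Finsupp.single_add]
    rw [add_neg_cancel, Finsupp.single_zero]
  · rintro ⟨i, j⟩ - - h
    exact Fin.succAbove_ne i j (congrArg Prod.fst h)
  · simp
  · rintro ⟨i, j⟩ -
    simp [Fin.succAbove_succAbove_predAbove, Fin.predAbove_predAbove_succAbove]

theorem boundaries_le_cycles (R : Type*) [CommRing R] {V : Type*} (G : Digraph V) (p : ℕ) :
    boundaries R G p ≤ cycles R G p := by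
  rintro _ ⟨x, hx, rfl⟩
  refine ⟨⟨hx.2, ?_⟩, boundary_boundary R V p x⟩
  change boundary R V p (boundary R V (p + 1) x) ∈ allowedPaths R G p
  rw [boundary_boundary]
  exact zero_mem _

/-- The quotient of a submodule `Z` by a submodule `B`; used only for `B ≤ Z`. -/
abbrev Subquotient {R M : Type*} [CommRing R] [AddCommGroup M] [Module R M]
    (Z B : Submodule R M) : Type _ :=
  Z ⧸ B.submoduleOf Z

/-- The `p`-th non-regular path homology module `ker ∂_p / im ∂_{p+1}`. -/
abbrev Homology (R : Type*) [CommRing R] {V : Type*} (G : Digraph V) (p : ℕ) : Type _ :=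
  Subquotient (cycles R G p) (boundaries R G p)

/-- The `p`-th non-regular Betti number `β_p(G; R)`, the rank of the homology. -/
def betti (R : Type*) [CommRing R] {V : Type*} (G : Digraph V) (p : ℕ) : ℕ :=
  Module.finrank R (Homology R G p)

/-! ### The Erdős–Rényi random directed graph -/

/-- The ordered pairs of distinct vertices, i.e. the possible edges of a simple digraph. -/
def possibleEdges (n : ℕ) : Set (Fin n × Fin n) := {e | e.1 ≠ e.2}

/-- The digraph with a given set of edges. -/
def ofEdgeSet {n : ℕ} (S : Set (Fin n × Fin n)) : Digraph (Fin n) where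
  Adj i j := (i, j) ∈ S

instance instMeasurableSpaceDigraph (n : ℕ) : MeasurableSpace (Digraph (Fin n)) := ⊤

/-- The law of the random digraph on `n` vertices in which each directed edge `(i, j)`, `i ≠ j`,
is included independently with probability `p` (and there are no loops). -/
def randomDigraph (n : ℕ) (p : unitInterval) : Measure (Digraph (Fin n)) :=
  (setBernoulli (possibleEdges n) p).map ofEdgeSet

theorem measurable_ofEdgeSet (n : ℕ) :
    Measurable (ofEdgeSet : Set (Fin n × Fin n) → Digraph (Fin n)) := fun s _ =>
  (Set.toFinite (ofEdgeSet ⁻¹' s)).measurableSet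

instance instIsProbabilityMeasureRandomDigraph (n : ℕ) (p : unitInterval) :
    IsProbabilityMeasure (randomDigraph n p) :=
  Measure.isProbabilityMeasure_map (measurable_ofEdgeSet n).aemeasurable

/-- A given simple digraph with `m` edges appears with probability `p^m (1-p)^(n(n-1)-m)`. -/
theorem randomDigraph_real_singleton (n : ℕ) (p : unitInterval) (S : Set (Fin n × Fin n))
    (hS : S ⊆ possibleEdges n) :
    (randomDigraph n p).real {ofEdgeSet S} =
      (p : ℝ) ^ S.ncard * (1 - (p : ℝ)) ^ (n * (n - 1) - S.ncard) := by
  have hinj : Function.Injective (ofEdgeSet : Set (Fin n × Fin n) → Digraph (Fin n)) := by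
    intro A B h
    ext ⟨i, j⟩
    exact iff_of_eq (congrFun (congrFun (congrArg Digraph.Adj h) i) j)
  have hcard : (possibleEdges n).ncard = n * (n - 1) := by
    have h : possibleEdges n = ((Finset.univ : Finset (Fin n)).offDiag : Set (Fin n × Fin n)) := by
      ext e; simp [possibleEdges]
    rw [h, Set.ncard_coe_finset, Finset.offDiag_card, Finset.card_univ, Fintype.card_fin,
      Nat.mul_sub_one]
  rw [randomDigraph, map_measureReal_apply (measurable_ofEdgeSet n) trivial,
    ← Set.image_singleton, Set.preimage_image_eq _ hinj,
    setBernoulli_real_singleton p hS (Set.toFinite _), Set.ncard_sdiff' hS (Set.toFinite _), hcard]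

/-! ### The constants of the bound -/

/-- `c_m`: the number of shortcut edges of an undirected 3-path of the `m`-th class. -/
def shortcutCount : Fin 4 → ℕ := ![2, 4, 4, 4]

/-- The matrix `Q = (q_{m,l})`. -/
def centreCount : Matrix (Fin 4) (Fin 9) ℝ :=
  !![0, 0, 0, 2, 11, 22, 23, 8, 1;
     0, 0, 0, 4, 19, 33, 25, 8, 1;
     0, 0, 0, 4, 19, 33, 25, 8, 1;
     0, 0, 0, 2, 16, 34, 26, 8, 1]

end PathHomology

end

/-! The first homology is spanned by closed undirected walks. Fix a root in each component and a
walk from it to each vertex; every edge then equals, up to a term depending only on its boundary,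
the chain of a closed walk through the root. So it is enough that closed walks bound
(`cycles_le_boundaries_of_closed_walks`).

Two kinds of boundary are used: a transitive triangle, and the difference of two directed 2-paths
with common ends. If an undirected 3-path on distinct vertices always has either an edge that
shortens it or an outside vertex κ through which it can be rerouted as a, κ, d, then closed walks
shrink to length at most 3 (`closed_walk_mem_boundaries`). The short ones that need not bound are
double edges and directed triangles; they do bound once coned off by a common in- or out-neighbour.

Hence a positive Betti number forces a bad 3-path, double edge or directed triangle. The conditions
at different outside vertices involve disjoint sets of possible edges, so they are independent and
the probability of a fixed bad configuration is an explicit product (`real_isBadPath`,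
`real_subset_and_no_cone`). A union bound over positions gives the three terms. -/

noncomputable section

namespace PathHomology

/-! ### Undirected walks and the first homology -/

section Walks

variable {V : Type*} {G : Digraph V}

/-- The elementary `1`-path from `a` to `b`. -/
def edge (a b : V) : ElemPaths ℤ V 2 := Finsupp.single ![a, b] 1

theorem boundary_edge (a b : V) :
    boundary ℤ V 1 (edge a b) = Finsupp.single ![b] 1 - Finsupp.single ![a] 1 := by
  have h0 : (fun j : Fin 1 => ![a, b] ((0 : Fin 2).succAbove j)) = ![b] := by
    ext j; fin_cases j; rfl
  have h1 : (fun j : Fin 1 => ![a, b] ((1 : Fin 2).succAbove j)) = ![a] := by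
    ext j; fin_cases j; rfl
  have h : boundary ℤ V 1 (edge a b) = ∑ i : Fin 2,
      Finsupp.single (fun j => ![a, b] (i.succAbove j)) ((-1 : ℤ) ^ (i : ℕ)) := by
    simp [boundary, edge]
  rw [h, Fin.sum_univ_two, h0, h1]
  simp [sub_eq_add_neg]

theorem boundary_single_three (a b c : V) :
    boundary ℤ V 2 (Finsupp.single ![a, b, c] 1) = edge b c - edge a c + edge a b := by
  have h0 : (fun j : Fin 2 => ![a, b, c] ((0 : Fin 3).succAbove j)) = ![b, c] := by
    ext j; fin_cases j <;> rfl
  have h1 : (fun j : Fin 2 => ![a, b, c] ((1 : Fin 3).succAbove j)) = ![a, c] := by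
    ext j; fin_cases j <;> rfl
  have h2 : (fun j : Fin 2 => ![a, b, c] ((2 : Fin 3).succAbove j)) = ![a, b] := by
    ext j; fin_cases j <;> rfl
  have h : boundary ℤ V 2 (Finsupp.single ![a, b, c] 1) = ∑ i : Fin 3,
      Finsupp.single (fun j => ![a, b, c] (i.succAbove j)) ((-1 : ℤ) ^ (i : ℕ)) := by
    simp [boundary]
  rw [h, Fin.sum_univ_three, h0, h1, h2]
  simp [edge, sub_eq_add_neg]

theorem edge_mem_allowedPaths {a b : V} (h : G.Adj a b) : edge a b ∈ allowedPaths ℤ G 2 := by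
  refine Finsupp.single_mem_supported ℤ _ ?_
  intro i j hij
  fin_cases i <;> fin_cases j <;> simp_all

theorem single_three_mem_allowedPaths {a b c : V} (h : G.Adj a b) (h' : G.Adj b c) :
    Finsupp.single ![a, b, c] 1 ∈ allowedPaths ℤ G 3 := by
  refine Finsupp.single_mem_supported ℤ _ ?_
  intro i j hij
  fin_cases i <;> fin_cases j <;> simp_all

theorem triangle_mem_boundaries {a b c : V} (hab : G.Adj a b) (hbc : G.Adj b c)
    (hac : G.Adj a c) : edge a b + edge b c - edge a c ∈ boundaries ℤ G 1 := by
  refine ⟨Finsupp.single ![a, b, c] 1, ⟨single_three_mem_allowedPaths hab hbc, ?_⟩, ?_⟩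
  · change boundary ℤ V 2 _ ∈ allowedPaths ℤ G 2
    rw [boundary_single_three]
    exact add_mem (sub_mem (edge_mem_allowedPaths hbc) (edge_mem_allowedPaths hac))
      (edge_mem_allowedPaths hab)
  · rw [boundary_single_three]
    abel

/-- The terms `edge a c` of the two 2-paths cancel, so a and c need not be adjacent. They may even
coincide: the non-allowed loop terms then cancel too, and two double edges at one vertex are
homologous. -/
theorem square_mem_boundaries {a b c d : V} (hab : G.Adj a b) (hbc : G.Adj b c)
    (had : G.Adj a d) (hdc : G.Adj d c) :
    edge a b + edge b c - edge a d - edge d c ∈ boundaries ℤ G 1 := by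
  have key : boundary ℤ V 2 (Finsupp.single ![a, b, c] 1 - Finsupp.single ![a, d, c] 1) =
      edge a b + edge b c - edge a d - edge d c := by
    rw [map_sub, boundary_single_three, boundary_single_three]
    abel
  refine ⟨_, ⟨sub_mem (single_three_mem_allowedPaths hab hbc)
    (single_three_mem_allowedPaths had hdc), ?_⟩, key⟩
  change boundary ℤ V 2 _ ∈ allowedPaths ℤ G 2
  rw [key]
  exact sub_mem (sub_mem (add_mem (edge_mem_allowedPaths hab) (edge_mem_allowedPaths hbc))
    (edge_mem_allowedPaths had)) (edge_mem_allowedPaths hdc)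

variable (G) in
/-- `Step G a b x`: there is an edge between `a` and `b`, and `x` is the `1`-chain obtained by
traversing it from `a` to `b`. -/
inductive Step (a b : V) : ElemPaths ℤ V 2 → Prop
  | forward (h : G.Adj a b) : Step a b (edge a b)
  | backward (h : G.Adj b a) : Step a b (-edge b a)

variable (G) in
/-- `UWalk G a b k x`: there is an undirected walk of length `k` from `a` to `b` with
associated `1`-chain `x`. -/
inductive UWalk : V → V → ℕ → ElemPaths ℤ V 2 → Prop
  | nil (a : V) : UWalk a a 0 0
  | cons {a b c : V} {k : ℕ} {x y : ElemPaths ℤ V 2} (h : Step G a b x) (t : UWalk b c k y) :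
      UWalk a c (k + 1) (x + y)

theorem Step.reverse {a b : V} {x : ElemPaths ℤ V 2} (h : Step G a b x) : Step G b a (-x) := by
  cases h with
  | forward h => exact .backward h
  | backward h => rw [neg_neg]; exact .forward h

theorem Step.uWalk {a b : V} {x : ElemPaths ℤ V 2} (h : Step G a b x) : UWalk G a b 1 x := by
  simpa using UWalk.cons h (.nil b)

theorem UWalk.append {a b c : V} {k l : ℕ} {x y : ElemPaths ℤ V 2} (h : UWalk G a b k x)
    (h' : UWalk G b c l y) : UWalk G a c (k + l) (x + y) := by
  induction h with
  | nil a => simpa using h'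
  | cons s _ ih => convert UWalk.cons s (ih h') using 1 <;> [omega; abel]

theorem UWalk.reverse {a b : V} {k : ℕ} {x : ElemPaths ℤ V 2} (h : UWalk G a b k x) :
    UWalk G b a k (-x) := by
  induction h with
  | nil a => simpa using UWalk.nil a
  | cons s _ ih => rw [neg_add_rev]; exact ih.append s.reverse.uWalk

/-- If all closed walks bound, then the first homology vanishes. -/
theorem cycles_le_boundaries_of_closed_walks
    (hG : ∀ k a x, UWalk G a a k x → x ∈ boundaries ℤ G 1) :
    cycles ℤ G 1 ≤ boundaries ℤ G 1 := by
  let R : Setoid V :=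
    { r := fun a b => ∃ k x, UWalk G a b k x
      iseqv := ⟨fun a => ⟨0, 0, .nil a⟩, fun ⟨k, x, h⟩ => ⟨k, -x, h.reverse⟩,
        fun ⟨k, x, h⟩ ⟨l, y, h'⟩ => ⟨k + l, x + y, h.append h'⟩⟩ }
  -- The chosen walks from `root v` to `v` play the role of a spanning forest.
  let root : V → V := fun v => (Quotient.mk R v).out
  have hroot : ∀ v, ∃ k x, UWalk G (root v) v k x := fun v => Quotient.mk_out (s := R) v
  choose len h hh using hroot
  -- `H` acts as a chain homotopy: the identity minus `H ∘ ∂` sends each edge to the closed walk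
  -- root, tail, head, root, and it fixes every cycle.
  let H : ElemPaths ℤ V 1 →ₗ[ℤ] ElemPaths ℤ V 2 :=
    Finsupp.linearCombination ℤ fun v => h (v 0)
  have hH : ∀ a : V, H (Finsupp.single ![a] 1) = h a := fun a => by simp [H]
  have hedge : allowedPaths ℤ G 2 ≤
      (boundaries ℤ G 1).comap (LinearMap.id - H ∘ₗ boundary ℤ V 1) := by
    rw [allowedPaths, Finsupp.supported_eq_span_single, Submodule.span_le]
    rintro _ ⟨v, hv, rfl⟩
    have hadj : G.Adj (v 0) (v 1) := hv 0 1 rfl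
    have hr : root (v 0) = root (v 1) := by
      refine congrArg Quotient.out (Quotient.sound (s := R) ?_)
      exact ⟨1, _, (Step.forward hadj).uWalk⟩
    have hv' : v = ![v 0, v 1] := by ext j; fin_cases j <;> rfl
    have hw := ((hh (v 0)).append (Step.forward hadj).uWalk).append (hr ▸ (hh (v 1)).reverse)
    have := hG _ _ _ hw
    rw [hv']
    change edge (v 0) (v 1) - H (boundary ℤ V 1 (edge (v 0) (v 1))) ∈ boundaries ℤ G 1
    rw [boundary_edge, map_sub, hH, hH]
    convert this using 1
    abel
  rintro x ⟨hx, hx0⟩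
  have := hedge hx.1
  have h0 : boundary ℤ V 1 x = 0 := hx0
  simpa [h0] using this

theorem betti_eq_zero_of_cycles_le_boundaries (h : cycles ℤ G 1 ≤ boundaries ℤ G 1) :
    betti ℤ G 1 = 0 := by
  have : Subsingleton (Homology ℤ G 1) := by
    rw [Homology, Subquotient, Submodule.Quotient.subsingleton_iff,
      Submodule.submoduleOf_eq_top]
    exact h
  exact Module.finrank_zero_of_subsingleton

end Walks

/-! ### Shortcuts and centres of undirected paths of length three -/

/-- The edges of an undirected path of length three on the vertices `0, 1, 2, 3`, for each of the
four possible orientations up to reversal. -/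
def pathEdges : Fin 4 → Finset (Fin 4 × Fin 4) :=
  ![{(0, 1), (1, 2), (2, 3)},
    {(0, 1), (1, 2), (3, 2)},
    {(1, 0), (1, 2), (2, 3)},
    {(0, 1), (2, 1), (2, 3)}]

/-- The edges which shorten an undirected path of length three. -/
def shortcutEdges : Fin 4 → Finset (Fin 4 × Fin 4) :=
  ![{(0, 2), (1, 3)},
    {(0, 2), (1, 3), (3, 1), (0, 3)},
    {(0, 2), (2, 0), (1, 3), (0, 3)},
    {(0, 2), (2, 0), (1, 3), (3, 1)}]

/-- Sets of edges between an undirected path of length three and a further vertex `κ` which allow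
to replace the path by a path through `κ`. The entry `i < 4` stands for the edge from the `i`-th
vertex to `κ`, the entry `4 + i` for the edge from `κ` to the `i`-th vertex. -/
def centreWitnesses : Fin 4 → List (List (Fin 8)) :=
  ![[[0, 1, 2, 3], [0, 2, 3, 4, 5, 6], [1, 2, 3, 4, 5, 6], [0, 1, 7], [1, 2, 3, 4, 5, 7],
      [0, 6, 7], [4, 5, 6, 7]],
    [[0, 1, 2, 3], [0, 3, 6], [3, 4, 5, 6], [0, 5, 7], [4, 5, 7], [0, 6, 7]],
    [[0, 2, 3], [1, 2, 3, 4], [0, 1, 7], [0, 2, 7], [1, 4, 7], [4, 5, 6, 7]],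
    [[0, 1, 3], [0, 2, 3, 5], [2, 3, 4, 5], [0, 1, 2, 7], [0, 2, 5, 7], [2, 4, 5, 7], [4, 6, 7],
      [0, 5, 6, 7]]]

section Shortening

variable {V : Type*} {G : Digraph V}

/-- The `j`-th of the eight possible edges between the vertices `v i` and `κ`. -/
def centreEdge (v : Fin 4 → V) (κ : V) : Fin 8 → V × V :=
  ![(v 0, κ), (v 1, κ), (v 2, κ), (v 3, κ), (κ, v 0), (κ, v 1), (κ, v 2), (κ, v 3)]

variable (G) in
/-- The vertices `v 0, v 1, v 2, v 3` span an undirected path of the `m`-th orientation, without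
shortcuts and without centres. -/
def IsBadPath (m : Fin 4) (v : Fin 4 → V) : Prop :=
  ((∀ e ∈ pathEdges m, G.Adj (v e.1) (v e.2)) ∧ ∀ e ∈ shortcutEdges m, ¬G.Adj (v e.1) (v e.2)) ∧
    ∀ κ, (∀ i, v i ≠ κ) → ∀ w ∈ centreWitnesses m,
      ∃ j ∈ w, ¬G.Adj (centreEdge v κ j).1 (centreEdge v κ j).2

variable (G) in
/-- Modulo boundaries, the chain `x` comes from an undirected walk of length at most two from `a`
to `b`. -/
def Shortens (a b : V) (x : ElemPaths ℤ V 2) : Prop :=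
  ∃ k ≤ 2, ∃ y, UWalk G a b k y ∧ x - y ∈ boundaries ℤ G 1

theorem Shortens.of_step {a b : V} {x y : ElemPaths ℤ V 2} (s : Step G a b y)
    (h : x - y ∈ boundaries ℤ G 1) : Shortens G a b x :=
  ⟨1, one_le_two, y, s.uWalk, h⟩

theorem Shortens.of_steps {a b c : V} {x y z : ElemPaths ℤ V 2} (s : Step G a b y)
    (t : Step G b c z) (h : x - (y + z) ∈ boundaries ℤ G 1) : Shortens G a c x :=
  ⟨2, le_rfl, y + z, s.uWalk.append t.uWalk, h⟩

theorem Shortens.reverse {a b : V} {x : ElemPaths ℤ V 2} (h : Shortens G a b x) :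
    Shortens G b a (-x) := by
  obtain ⟨k, hk, y, hy, hxy⟩ := h
  refine ⟨k, hk, -y, hy.reverse, ?_⟩
  rw [← neg_sub_neg, neg_neg, neg_neg, ← neg_sub]
  exact neg_mem hxy

/-- If no shortening existed, every shortcut and every witness would have to be absent, and the path
would be bad. A witness at κ fills the region between the path and a, κ, d by triangles and squares,
so each list contains an edge joining κ to a and one joining κ to d. The chords c → a and d → b are
no shortcuts: they close directed triangles, which need not bound. -/
theorem shortens_of_not_isBadPath_zero {a b c d : V} (h : ¬IsBadPath G 0 ![a, b, c, d])
    (hab : G.Adj a b) (hbc : G.Adj b c) (hcd : G.Adj c d) :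
    Shortens G a d (edge a b + edge b c + edge c d) := by
  by_contra hs
  refine h ⟨⟨by simp [pathEdges, *], ?_⟩, fun k _ w hw => by_contra fun hn => hs ?_⟩
  · have hS : ¬G.Adj a c ∧ ¬G.Adj b d := by
      refine ⟨fun hac => hs ?_, fun hbd => hs ?_⟩
      · exact .of_steps (.forward hac) (.forward hcd) <| by
          convert triangle_mem_boundaries hab hbc hac using 1; abel
      · exact .of_steps (.forward hab) (.forward hbd) <| by
          convert triangle_mem_boundaries hbc hcd hbd using 1; abel
    simpa [shortcutEdges] using hS
  · simp only [not_exists, not_and, not_not] at hn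
    simp [centreWitnesses] at hw
    rcases hw with rfl | rfl | rfl | rfl | rfl | rfl | rfl
    · obtain ⟨hak, hbk, hck, hdk⟩ := by simpa [centreEdge] using hn
      exact .of_steps (.forward hak) (.backward hdk) <| by
        convert add_mem (add_mem (triangle_mem_boundaries hab hbk hak)
          (triangle_mem_boundaries hbc hck hbk)) (triangle_mem_boundaries hcd hdk hck) using 1; abel
    · obtain ⟨hak, hck, hdk, hka, hkb, hkc⟩ := by simpa [centreEdge] using hn
      exact .of_steps (.forward hak) (.backward hdk) <| by
        -- The square is degenerate: it trades the double edge between κ and a for the one between κ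
        -- and c.
        convert sub_mem (add_mem (add_mem (triangle_mem_boundaries hka hab hkb)
          (triangle_mem_boundaries hcd hdk hck)) (triangle_mem_boundaries hkb hbc hkc))
          (square_mem_boundaries hka hak hkc hck) using 1; abel
    · obtain ⟨hbk, hck, hdk, hka, hkb, hkc⟩ := by simpa [centreEdge] using hn
      exact .of_steps (.backward hka) (.backward hdk) <| by
        convert add_mem (add_mem (add_mem (add_mem (triangle_mem_boundaries hbc hck hbk)
          (triangle_mem_boundaries hka hab hkb)) (triangle_mem_boundaries hbk hkc hbc))
          (triangle_mem_boundaries hcd hdk hck)) (triangle_mem_boundaries hkb hbc hkc) using 1; abel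
    · obtain ⟨hak, hbk, hkd⟩ := by simpa [centreEdge] using hn
      exact .of_steps (.forward hak) (.forward hkd) <| by
        convert add_mem (triangle_mem_boundaries hab hbk hak)
          (square_mem_boundaries hbc hcd hbk hkd) using 1; abel
    · obtain ⟨hbk, hck, hdk, hka, hkb, hkd⟩ := by simpa [centreEdge] using hn
      exact .of_steps (.backward hka) (.forward hkd) <| by
        convert add_mem (add_mem (add_mem (triangle_mem_boundaries hbc hck hbk)
          (triangle_mem_boundaries hka hab hkb)) (triangle_mem_boundaries hcd hdk hck))
          (square_mem_boundaries hkb hbk hkd hdk) using 1; abel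
    · obtain ⟨hak, hkc, hkd⟩ := by simpa [centreEdge] using hn
      exact .of_steps (.forward hak) (.forward hkd) <| by
        convert add_mem (square_mem_boundaries hab hbc hak hkc)
          (triangle_mem_boundaries hkc hcd hkd) using 1; abel
    · obtain ⟨hka, hkb, hkc, hkd⟩ := by simpa [centreEdge] using hn
      exact .of_steps (.backward hka) (.forward hkd) <| by
        convert add_mem (add_mem (triangle_mem_boundaries hka hab hkb)
          (triangle_mem_boundaries hkc hcd hkd)) (triangle_mem_boundaries hkb hbc hkc) using 1; abel

/-- Besides chords, the edge a → d is a shortcut: with the path it forms a square from a to c, and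
three steps become one. -/
theorem shortens_of_not_isBadPath_one {a b c d : V} (h : ¬IsBadPath G 1 ![a, b, c, d])
    (hab : G.Adj a b) (hbc : G.Adj b c) (hdc : G.Adj d c) :
    Shortens G a d (edge a b + edge b c - edge d c) := by
  by_contra hs
  refine h ⟨⟨by simp [pathEdges, *], ?_⟩, fun k _ w hw => by_contra fun hn => hs ?_⟩
  · have hS : ¬G.Adj a c ∧ ¬G.Adj b d ∧ ¬G.Adj d b ∧ ¬G.Adj a d := by
      refine ⟨fun hac => hs ?_, fun hbd => hs ?_, fun hdb => hs ?_, fun had => hs ?_⟩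
      · exact .of_steps (.forward hac) (.backward hdc) <| by
          convert triangle_mem_boundaries hab hbc hac using 1; abel
      · exact .of_steps (.forward hab) (.forward hbd) <| by
          convert neg_mem (triangle_mem_boundaries hbd hdc hbc) using 1; abel
      · exact .of_steps (.forward hab) (.backward hdb) <| by
          convert triangle_mem_boundaries hdb hbc hdc using 1; abel
      · exact .of_step (.forward had) <| by
          convert square_mem_boundaries hab hbc had hdc using 1; abel
    simpa [shortcutEdges] using hS
  · simp only [not_exists, not_and, not_not] at hn
    simp [centreWitnesses] at hw
    rcases hw with rfl | rfl | rfl | rfl | rfl | rfl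
    · obtain ⟨hak, hbk, hck, hdk⟩ := by simpa [centreEdge] using hn
      exact .of_steps (.forward hak) (.backward hdk) <| by
        convert sub_mem (add_mem (triangle_mem_boundaries hab hbk hak)
          (triangle_mem_boundaries hbc hck hbk)) (triangle_mem_boundaries hdc hck hdk) using 1; abel
    · obtain ⟨hak, hdk, hkc⟩ := by simpa [centreEdge] using hn
      exact .of_steps (.forward hak) (.backward hdk) <| by
        convert add_mem (square_mem_boundaries hab hbc hak hkc)
          (triangle_mem_boundaries hdk hkc hdc) using 1; abel
    · obtain ⟨hdk, hka, hkb, hkc⟩ := by simpa [centreEdge] using hn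
      exact .of_steps (.backward hka) (.backward hdk) <| by
        convert add_mem (add_mem (triangle_mem_boundaries hka hab hkb)
          (triangle_mem_boundaries hdk hkc hdc)) (triangle_mem_boundaries hkb hbc hkc) using 1; abel
    · obtain ⟨hak, hkb, hkd⟩ := by simpa [centreEdge] using hn
      exact .of_steps (.forward hak) (.forward hkd) <| by
        convert sub_mem (square_mem_boundaries hkb hbc hkd hdc)
          (triangle_mem_boundaries hak hkb hab) using 1; abel
    · obtain ⟨hka, hkb, hkd⟩ := by simpa [centreEdge] using hn
      exact .of_steps (.backward hka) (.forward hkd) <| by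
        convert add_mem (triangle_mem_boundaries hka hab hkb)
          (square_mem_boundaries hkb hbc hkd hdc) using 1; abel
    · obtain ⟨hak, hkc, hkd⟩ := by simpa [centreEdge] using hn
      exact .of_steps (.forward hak) (.forward hkd) <| by
        convert sub_mem (square_mem_boundaries hab hbc hak hkc)
          (triangle_mem_boundaries hkd hdc hkc) using 1; abel

theorem shortens_of_not_isBadPath_two {a b c d : V} (h : ¬IsBadPath G 2 ![a, b, c, d])
    (hba : G.Adj b a) (hbc : G.Adj b c) (hcd : G.Adj c d) :
    Shortens G a d (-edge b a + edge b c + edge c d) := by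
  by_contra hs
  refine h ⟨⟨by simp [pathEdges, *], ?_⟩, fun k _ w hw => by_contra fun hn => hs ?_⟩
  · have hS : ¬G.Adj a c ∧ ¬G.Adj c a ∧ ¬G.Adj b d ∧ ¬G.Adj a d := by
      refine ⟨fun hac => hs ?_, fun hca => hs ?_, fun hbd => hs ?_, fun had => hs ?_⟩
      · exact .of_steps (.forward hac) (.forward hcd) <| by
          convert neg_mem (triangle_mem_boundaries hba hac hbc) using 1; abel
      · exact .of_steps (.backward hca) (.forward hcd) <| by
          convert triangle_mem_boundaries hbc hca hba using 1; abel
      · exact .of_steps (.backward hba) (.forward hbd) <| by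
          convert triangle_mem_boundaries hbc hcd hbd using 1; abel
      · exact .of_step (.forward had) <| by
          convert neg_mem (square_mem_boundaries hba had hbc hcd) using 1; abel
    simpa [shortcutEdges] using hS
  · simp only [not_exists, not_and, not_not] at hn
    simp [centreWitnesses] at hw
    rcases hw with rfl | rfl | rfl | rfl | rfl | rfl
    · obtain ⟨hak, hck, hdk⟩ := by simpa [centreEdge] using hn
      exact .of_steps (.forward hak) (.backward hdk) <| by
        convert sub_mem (triangle_mem_boundaries hcd hdk hck)
          (square_mem_boundaries hba hak hbc hck) using 1; abel
    · obtain ⟨hbk, hck, hdk, hka⟩ := by simpa [centreEdge] using hn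
      exact .of_steps (.backward hka) (.backward hdk) <| by
        convert add_mem (add_mem (triangle_mem_boundaries hbc hck hbk)
          (triangle_mem_boundaries hbk hka hba)) (triangle_mem_boundaries hcd hdk hck) using 1; abel
    · obtain ⟨hak, hbk, hkd⟩ := by simpa [centreEdge] using hn
      exact .of_steps (.forward hak) (.forward hkd) <| by
        convert sub_mem (square_mem_boundaries hbc hcd hbk hkd)
          (triangle_mem_boundaries hba hak hbk) using 1; abel
    · obtain ⟨hak, hck, hkd⟩ := by simpa [centreEdge] using hn
      exact .of_steps (.forward hak) (.forward hkd) <| by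
        convert sub_mem (neg_mem (triangle_mem_boundaries hck hkd hcd))
          (square_mem_boundaries hba hak hbc hck) using 1; abel
    · obtain ⟨hbk, hka, hkd⟩ := by simpa [centreEdge] using hn
      exact .of_steps (.backward hka) (.forward hkd) <| by
        convert add_mem (square_mem_boundaries hbc hcd hbk hkd)
          (triangle_mem_boundaries hbk hka hba) using 1; abel
    · obtain ⟨hka, hkb, hkc, hkd⟩ := by simpa [centreEdge] using hn
      exact .of_steps (.backward hka) (.forward hkd) <| by
        convert sub_mem (add_mem (triangle_mem_boundaries hkc hcd hkd)
          (triangle_mem_boundaries hkb hbc hkc)) (triangle_mem_boundaries hkb hba hka) using 1; abel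

/-- In the alternating orientation every chord, in either direction, completes a transitive triangle
with two path edges, whence the four shortcuts. -/
theorem shortens_of_not_isBadPath_three {a b c d : V} (h : ¬IsBadPath G 3 ![a, b, c, d])
    (hab : G.Adj a b) (hcb : G.Adj c b) (hcd : G.Adj c d) :
    Shortens G a d (edge a b - edge c b + edge c d) := by
  by_contra hs
  refine h ⟨⟨by simp [pathEdges, *], ?_⟩, fun k _ w hw => by_contra fun hn => hs ?_⟩
  · have hS : ¬G.Adj a c ∧ ¬G.Adj c a ∧ ¬G.Adj b d ∧ ¬G.Adj d b := by
      refine ⟨fun hac => hs ?_, fun hca => hs ?_, fun hbd => hs ?_, fun hdb => hs ?_⟩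
      · exact .of_steps (.forward hac) (.forward hcd) <| by
          convert neg_mem (triangle_mem_boundaries hac hcb hab) using 1; abel
      · exact .of_steps (.backward hca) (.forward hcd) <| by
          convert triangle_mem_boundaries hca hab hcb using 1; abel
      · exact .of_steps (.forward hab) (.forward hbd) <| by
          convert neg_mem (triangle_mem_boundaries hcb hbd hcd) using 1; abel
      · exact .of_steps (.forward hab) (.backward hdb) <| by
          convert triangle_mem_boundaries hcd hdb hcb using 1; abel
    simpa [shortcutEdges] using hS
  · simp only [not_exists, not_and, not_not] at hn
    simp [centreWitnesses] at hw
    rcases hw with rfl | rfl | rfl | rfl | rfl | rfl | rfl | rfl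
    · obtain ⟨hak, hbk, hdk⟩ := by simpa [centreEdge] using hn
      exact .of_steps (.forward hak) (.backward hdk) <| by
        convert sub_mem (triangle_mem_boundaries hab hbk hak)
          (square_mem_boundaries hcb hbk hcd hdk) using 1; abel
    · obtain ⟨hak, hck, hdk, hkb⟩ := by simpa [centreEdge] using hn
      exact .of_steps (.forward hak) (.backward hdk) <| by
        convert sub_mem (add_mem (triangle_mem_boundaries hck hkb hcb)
          (triangle_mem_boundaries hcd hdk hck)) (triangle_mem_boundaries hak hkb hab) using 1; abel
    · obtain ⟨hck, hdk, hka, hkb⟩ := by simpa [centreEdge] using hn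
      exact .of_steps (.backward hka) (.backward hdk) <| by
        convert add_mem (add_mem (triangle_mem_boundaries hck hkb hcb)
          (triangle_mem_boundaries hka hab hkb)) (triangle_mem_boundaries hcd hdk hck) using 1; abel
    · obtain ⟨hak, hbk, hck, hkd⟩ := by simpa [centreEdge] using hn
      exact .of_steps (.forward hak) (.forward hkd) <| by
        convert sub_mem (sub_mem (triangle_mem_boundaries hab hbk hak)
          (triangle_mem_boundaries hck hkd hcd)) (triangle_mem_boundaries hcb hbk hck) using 1; abel
    · obtain ⟨hak, hck, hkb, hkd⟩ := by simpa [centreEdge] using hn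
      exact .of_steps (.forward hak) (.forward hkd) <| by
        convert sub_mem (sub_mem (triangle_mem_boundaries hck hkb hcb)
          (triangle_mem_boundaries hck hkd hcd)) (triangle_mem_boundaries hak hkb hab) using 1; abel
    · obtain ⟨hck, hka, hkb, hkd⟩ := by simpa [centreEdge] using hn
      exact .of_steps (.backward hka) (.forward hkd) <| by
        convert sub_mem (add_mem (triangle_mem_boundaries hck hkb hcb)
          (triangle_mem_boundaries hka hab hkb)) (triangle_mem_boundaries hck hkd hcd) using 1; abel
    · obtain ⟨hka, hkc, hkd⟩ := by simpa [centreEdge] using hn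
      exact .of_steps (.backward hka) (.forward hkd) <| by
        convert add_mem (square_mem_boundaries hka hab hkc hcb)
          (triangle_mem_boundaries hkc hcd hkd) using 1; abel
    · obtain ⟨hak, hkb, hkc, hkd⟩ := by simpa [centreEdge] using hn
      exact .of_steps (.forward hak) (.forward hkd) <| by
        convert sub_mem (sub_mem (triangle_mem_boundaries hkc hcd hkd)
          (triangle_mem_boundaries hak hkb hab)) (triangle_mem_boundaries hkc hcb hkb) using 1; abel

end Shortening

/-! ### Vanishing of the first homology in the absence of bad configurations -/

section Vanishing

variable {V : Type*} {G : Digraph V}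

variable (G) in
/-- A double edge without a common in- or out-neighbour. -/
def IsBadPair (a b : V) : Prop :=
  (G.Adj a b ∧ G.Adj b a) ∧
    ∀ κ, κ ≠ a → κ ≠ b → ¬(G.Adj κ a ∧ G.Adj κ b) ∧ ¬(G.Adj a κ ∧ G.Adj b κ)

variable (G) in
/-- A directed triangle without a common in- or out-neighbour. -/
def IsBadTriangle (a b c : V) : Prop :=
  (G.Adj a b ∧ G.Adj b c ∧ G.Adj c a) ∧
    ∀ κ, κ ≠ a → κ ≠ b → κ ≠ c →
      ¬(G.Adj κ a ∧ G.Adj κ b ∧ G.Adj κ c) ∧ ¬(G.Adj a κ ∧ G.Adj b κ ∧ G.Adj c κ)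

/-- In the non-regular theory the boundary of the path a b a contains the loop a a, so without loops
this path is not invariant. A common neighbour κ instead cones off the double edge by two triangles.
-/
theorem double_edge_mem_boundaries {a b : V} (h : ¬IsBadPair G a b) (hab : G.Adj a b)
    (hba : G.Adj b a) : edge a b + edge b a ∈ boundaries ℤ G 1 := by
  by_contra hB
  refine h ⟨⟨hab, hba⟩, fun k _ _ => ⟨fun ⟨hka, hkb⟩ => hB ?_, fun ⟨hak, hbk⟩ => hB ?_⟩⟩
  · convert add_mem (triangle_mem_boundaries hka hab hkb) (triangle_mem_boundaries hkb hba hka)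
      using 1
    abel
  · convert add_mem (triangle_mem_boundaries hab hbk hak) (triangle_mem_boundaries hba hak hbk)
      using 1
    abel

theorem directed_triangle_mem_boundaries {a b c : V} (h : ¬IsBadTriangle G a b c)
    (hab : G.Adj a b) (hbc : G.Adj b c) (hca : G.Adj c a) :
    edge a b + edge b c + edge c a ∈ boundaries ℤ G 1 := by
  by_contra hB
  refine h ⟨⟨hab, hbc, hca⟩, fun k _ _ _ =>
    ⟨fun ⟨hka, hkb, hkc⟩ => hB ?_, fun ⟨hak, hbk, hck⟩ => hB ?_⟩⟩
  · convert add_mem (add_mem (triangle_mem_boundaries hka hab hkb)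
      (triangle_mem_boundaries hkb hbc hkc)) (triangle_mem_boundaries hkc hca hka) using 1
    abel
  · convert add_mem (add_mem (triangle_mem_boundaries hab hbk hak)
      (triangle_mem_boundaries hbc hck hbk)) (triangle_mem_boundaries hca hak hck) using 1
    abel

theorem closed_walk_two_mem_boundaries (hG : ∀ a b, ¬IsBadPair G a b) {a b : V}
    {x y : ElemPaths ℤ V 2} (hx : Step G a b x) (hy : Step G b a y) :
    x + y ∈ boundaries ℤ G 1 := by
  cases hx with
  | forward hab =>
    cases hy with
    | forward hba => exact double_edge_mem_boundaries (hG a b) hab hba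
    | backward _ => simp
  | backward hba =>
    cases hy with
    | forward _ => simp
    | backward hab =>
      convert neg_mem (double_edge_mem_boundaries (hG a b) hab hba) using 1
      abel

/-- Six of the eight orientations are transitive triangles; only the two cyclic ones need a cone. -/
theorem closed_walk_three_mem_boundaries (hG : ∀ a b c, ¬IsBadTriangle G a b c) {a b c : V}
    {x y z : ElemPaths ℤ V 2} (hx : Step G a b x) (hy : Step G b c y) (hz : Step G c a z) :
    x + y + z ∈ boundaries ℤ G 1 := by
  cases hx with
  | forward hab =>
    cases hy with
    | forward hbc =>
      cases hz with
      | forward hca => exact directed_triangle_mem_boundaries (hG a b c) hab hbc hca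
      | backward hac => convert triangle_mem_boundaries hab hbc hac using 1; abel
    | backward hcb =>
      cases hz with
      | forward hca => convert triangle_mem_boundaries hca hab hcb using 1; abel
      | backward hac => convert neg_mem (triangle_mem_boundaries hac hcb hab) using 1; abel
  | backward hba =>
    cases hy with
    | forward hbc =>
      cases hz with
      | forward hca => convert triangle_mem_boundaries hbc hca hba using 1; abel
      | backward hac => convert neg_mem (triangle_mem_boundaries hba hac hbc) using 1; abel
    | backward hcb =>
      cases hz with
      | forward hca => convert neg_mem (triangle_mem_boundaries hcb hba hca) using 1; abel
      | backward hac =>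
        convert neg_mem (directed_triangle_mem_boundaries (hG c b a) hcb hba hac) using 1; abel

/-- Reversing the path flips its middle edge, so the eight orientations form four classes of two.
The four orientations not listed are read from d to a. -/
theorem shortens_of_steps (hG : ∀ m v, Function.Injective v → ¬IsBadPath G m v) {a b c d : V}
    (hab : a ≠ b) (hac : a ≠ c) (had : a ≠ d) (hbc : b ≠ c) (hbd : b ≠ d) (hcd : c ≠ d)
    {x y z : ElemPaths ℤ V 2} (hx : Step G a b x) (hy : Step G b c y) (hz : Step G c d z) :
    Shortens G a d (x + y + z) := by
  have h : ∀ m, ¬IsBadPath G m ![a, b, c, d] := fun m => hG m _ <| by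
    intro i j
    fin_cases i <;> fin_cases j <;> simp [*, Ne.symm]
  have h' : ∀ m, ¬IsBadPath G m ![d, c, b, a] := fun m => hG m _ <| by
    intro i j
    fin_cases i <;> fin_cases j <;> simp [*, Ne.symm]
  cases hx with
  | forward hab =>
    cases hy with
    | forward hbc =>
      cases hz with
      | forward hcd => exact shortens_of_not_isBadPath_zero (h 0) hab hbc hcd
      | backward hdc => convert shortens_of_not_isBadPath_one (h 1) hab hbc hdc using 1; abel
    | backward hcb =>
      cases hz with
      | forward hcd => convert shortens_of_not_isBadPath_three (h 3) hab hcb hcd using 1; abel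
      | backward hdc =>
        convert (shortens_of_not_isBadPath_one (h' 1) hdc hcb hab).reverse using 1; abel
  | backward hba =>
    cases hy with
    | forward hbc =>
      cases hz with
      | forward hcd => exact shortens_of_not_isBadPath_two (h 2) hba hbc hcd
      | backward hdc =>
        convert (shortens_of_not_isBadPath_three (h' 3) hdc hbc hba).reverse using 1; abel
    | backward hcb =>
      cases hz with
      | forward hcd =>
        convert (shortens_of_not_isBadPath_two (h' 2) hcd hcb hba).reverse using 1; abel
      | backward hdc =>
        convert (shortens_of_not_isBadPath_zero (h' 0) hdc hcb hba).reverse using 1; abel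

theorem Step.ne (hG : ∀ a, ¬G.Adj a a) {a b : V} {x : ElemPaths ℤ V 2} (h : Step G a b x) :
    a ≠ b := by
  rintro rfl
  cases h with
  | forward h => exact hG a h
  | backward h => exact hG a h

/-- A closed undirected walk bounds if there is no loop and no bad double edge, directed triangle
or path of length three. -/
theorem closed_walk_mem_boundaries (h1 : ∀ a, ¬G.Adj a a) (h2 : ∀ a b, ¬IsBadPair G a b)
    (h3 : ∀ a b c, ¬IsBadTriangle G a b c)
    (h4 : ∀ m v, Function.Injective v → ¬IsBadPath G m v) (k : ℕ) (a : V) (w : ElemPaths ℤ V 2)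
    (hw : UWalk G a a k w) : w ∈ boundaries ℤ G 1 := by
  induction k using Nat.strong_induction_on generalizing a w with
  | _ k ih =>
    -- An initial segment `s` may be replaced by a shorter walk with the same ends and a homologous
    -- chain; the resulting closed walk bounds by induction.
    have key : ∀ {a d : V} {k' l : ℕ} {w' x : ElemPaths ℤ V 2}, UWalk G d a k' w' →
        UWalk G a d l x → l + k' < k → ∀ {s : ElemPaths ℤ V 2}, s - x ∈ boundaries ℤ G 1 →
        s + w' ∈ boundaries ℤ G 1 := by
      intro a d k' l w' x hw' hx hl s hs
      have := add_mem hs (ih _ hl a _ (hx.append hw'))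
      convert this using 1
      abel
    cases hw with
    | nil => exact zero_mem _
    | @cons _ b _ k x w hx hw =>
    cases hw with
    | nil => exact absurd rfl (hx.ne h1)
    | @cons _ c _ k y w hy hw =>
    cases hw with
    | nil => simpa using closed_walk_two_mem_boundaries h2 hx hy
    | @cons _ d _ k z w hz hw =>
    have e : x + (y + (z + w)) = x + y + z + w := by abel
    rw [e]
    -- Coincidences among the first four vertices give a closed walk of length two or three, which
    -- bounds and can be dropped; otherwise the shortening of 3-paths applies.
    by_cases hac : a = c
    · subst hac
      refine key hw hz.uWalk (by omega) ?_
      simpa using closed_walk_two_mem_boundaries h2 hx hy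
    by_cases hbd : b = d
    · subst hbd
      refine key hw hx.uWalk (by omega) ?_
      convert closed_walk_two_mem_boundaries h2 hy hz using 1
      abel
    by_cases had : a = d
    · subst had
      refine key hw (.nil a) (by omega) ?_
      simpa using closed_walk_three_mem_boundaries h3 hx hy hz
    obtain ⟨l, hl, x', hx', hB⟩ := shortens_of_steps h4 (hx.ne h1) hac had (hy.ne h1) hbd
      (hz.ne h1) hx hy hz
    exact key hw hx' (by omega) hB

theorem betti_eq_zero (h1 : ∀ a, ¬G.Adj a a) (h2 : ∀ a b, ¬IsBadPair G a b)
    (h3 : ∀ a b c, ¬IsBadTriangle G a b c)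
    (h4 : ∀ m v, Function.Injective v → ¬IsBadPath G m v) : betti ℤ G 1 = 0 :=
  betti_eq_zero_of_cycles_le_boundaries <| cycles_le_boundaries_of_closed_walks <|
    closed_walk_mem_boundaries h1 h2 h3 h4

end Vanishing

/-! ### Independence for Bernoulli random sets -/

section RandomSets

theorem iIndepFun_mem {X : Type*} [Finite X] (u : Set X) (p : unitInterval) :
    iIndepFun (fun (x : X) (S : Set X) => x ∈ S) (setBernoulli u p) := by
  have hm : ∀ x : X, Measurable fun S : Set X => x ∈ S := fun x => by fun_prop
  have hm2 : Measurable fun q : X → Prop => {x | q x} :=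
    MeasurableEquiv.setOfPred.measurable
  rw [iIndepFun_iff_map_fun_eq_infinitePi_map hm, setBernoulli_eq_map,
    Measure.map_map (measurable_pi_iff.2 hm) hm2]
  have : ∀ x : X, Measure.map (fun S : Set X => x ∈ S)
      (Measure.map (fun q : X → Prop => {x | q x}) (Measure.infinitePi fun i : X =>
        unitInterval.toNNReal p • Measure.dirac (i ∈ u) +
          unitInterval.toNNReal (unitInterval.symm p) • Measure.dirac False)) =
      unitInterval.toNNReal p • Measure.dirac (x ∈ u) +
          unitInterval.toNNReal (unitInterval.symm p) • Measure.dirac False := fun x => by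
    rw [Measure.map_map (hm x) hm2]
    exact Measure.infinitePi_map_eval _ x
  simp_rw [this]
  -- Forming a set from a predicate and testing membership again is the identity, so the joint law
  -- is the product measure itself.
  exact Measure.map_id

/-- Membership of a set in the family `A` only depends on its intersection with `F`. -/
def DeterminedBy {X : Type*} (A : Set (Set X)) (F : Finset X) : Prop :=
  ∀ S T : Set X, (∀ x ∈ F, x ∈ S ↔ x ∈ T) → S ∈ A → T ∈ A

variable {X ι : Type*} [Finite X] {u : Set X} {p : unitInterval}

-- Each event is the preimage of its image under restriction to its finite set of coordinates, and
-- restrictions to disjoint sets are independent.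
open scoped Classical in
theorem real_inter_of_determinedBy {A B : Set (Set X)} {F F' : Finset X} (hA : DeterminedBy A F)
    (hB : DeterminedBy B F') (hF : Disjoint F F') :
    (setBernoulli u p).real (A ∩ B) = (setBernoulli u p).real A * (setBernoulli u p).real B := by
  have hm : ∀ x : X, Measurable fun S : Set X => x ∈ S := fun x => by fun_prop
  have h := (iIndepFun_mem u p).indepFun_finset F F' hF hm
  have key : ∀ {A : Set (Set X)} {F : Finset X}, DeterminedBy A F →
      A = (fun (S : Set X) (i : F) => (i : X) ∈ S) ⁻¹'
        ((fun (S : Set X) (i : F) => (i : X) ∈ S) '' A) := by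
    intro A F hA
    refine (Set.subset_preimage_image _ _).antisymm ?_
    rintro T ⟨S, hS, hST⟩
    exact hA S T (fun x hx => iff_of_eq (congrFun hST ⟨x, hx⟩)) hS
  have := h.measure_inter_preimage_eq_mul (s := (fun (S : Set X) (i : F) => (i : X) ∈ S) '' A)
    (t := (fun (S : Set X) (i : F') => (i : X) ∈ S) '' B)
    (Set.toFinite _).measurableSet (Set.toFinite _).measurableSet
  rw [← key hA, ← key hB] at this
  simp only [measureReal_def, this, ENNReal.toReal_mul]

open scoped Classical in
theorem real_forall_of_determinedBy (K : Finset ι) (A : ι → Set (Set X)) (F : ι → Finset X)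
    (hA : ∀ i ∈ K, DeterminedBy (A i) (F i))
    (hF : ∀ i ∈ K, ∀ j ∈ K, i ≠ j → Disjoint (F i) (F j)) :
    (setBernoulli u p).real {S | ∀ i ∈ K, S ∈ A i} = ∏ i ∈ K, (setBernoulli u p).real (A i) := by
  induction K using Finset.induction_on with
  | empty => simp
  | insert a K ha ih =>
    have hset : {S | ∀ i ∈ insert a K, S ∈ A i} = A a ∩ {S | ∀ i ∈ K, S ∈ A i} := by
      ext S; simp
    have hdet : DeterminedBy {S | ∀ i ∈ K, S ∈ A i} (K.biUnion F) := by
      intro S T hST hS i hi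
      exact hA i (Finset.mem_insert_of_mem hi) S T
        (fun x hx => hST x (Finset.mem_biUnion.2 ⟨i, hi, hx⟩)) (hS i hi)
    rw [hset, real_inter_of_determinedBy (hA a (Finset.mem_insert_self _ _)) hdet,
      Finset.prod_insert ha, ih]
    · exact fun i hi => hA i (Finset.mem_insert_of_mem hi)
    · exact fun i hi j hj => hF i (Finset.mem_insert_of_mem hi) j (Finset.mem_insert_of_mem hj)
    · refine (Finset.disjoint_biUnion_right _ _ _).2 fun i hi => ?_
      refine hF a (Finset.mem_insert_self _ _) i (Finset.mem_insert_of_mem hi) ?_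
      rintro rfl
      exact ha hi

theorem real_setOf_mem {X : Type*} {u : Set X} {p : unitInterval} {x : X} (hx : x ∈ u) :
    (setBernoulli u p).real {S | x ∈ S} = p := by
  rw [measureReal_def, setBernoulli_apply']
  have h := congrArg (fun μ => μ {True}) (Measure.infinitePi_map_eval
    (fun i : X => unitInterval.toNNReal p • Measure.dirac (i ∈ u) +
          unitInterval.toNNReal (unitInterval.symm p) • Measure.dirac False) x)
  rw [Measure.map_apply (by fun_prop) (Set.toFinite _).measurableSet] at h
  have h2 : (fun q : X → Prop => {i | q i}) ⁻¹' {S | x ∈ S} =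
      (fun q : X → Prop => q x) ⁻¹' {True} := by
    ext q; simp
  rw [h2, h]
  simp [hx]

theorem real_setOf_notMem {x : X} (hx : x ∈ u) :
    (setBernoulli u p).real {S | x ∉ S} = 1 - p := by
  have := probReal_compl_eq_one_sub (μ := setBernoulli u p) (s := {S : Set X | x ∈ S})
    (Set.toFinite _).measurableSet
  rw [real_setOf_mem hx] at this
  exact this

open scoped Classical in
theorem real_subset_and_disjoint {C D : Finset X} (hC : ∀ x ∈ C, x ∈ u) (hD : ∀ x ∈ D, x ∈ u)
    (hCD : Disjoint C D) :
    (setBernoulli u p).real {S | (∀ x ∈ C, x ∈ S) ∧ ∀ x ∈ D, x ∉ S} =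
      (p : ℝ) ^ C.card * (1 - p : ℝ) ^ D.card := by
  have h1 : ∀ x : X, DeterminedBy {S | x ∈ S} {x} := fun x S T hST hS => by
    simpa [← hST x] using hS
  have h2 : ∀ x : X, DeterminedBy {S | x ∉ S} {x} := fun x S T hST hS => by
    simpa [← hST x] using hS
  have hs : ∀ i j : X, i ≠ j → Disjoint ({i} : Finset X) {j} := fun i j h => by simpa using h
  have e1 := real_forall_of_determinedBy (u := u) (p := p) C (fun x => {S : Set X | x ∈ S})
    (fun x => {x}) (fun x _ => h1 x) (fun i _ j _ => hs i j)
  have e2 := real_forall_of_determinedBy (u := u) (p := p) D (fun x => {S : Set X | x ∉ S})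
    (fun x => {x}) (fun x _ => h2 x) (fun i _ j _ => hs i j)
  have d1 : DeterminedBy {S : Set X | ∀ x ∈ C, x ∈ S} C := fun S T hST hS x hx =>
    (hST x hx).1 (hS x hx)
  have d2 : DeterminedBy {S : Set X | ∀ x ∈ D, x ∉ S} D := fun S T hST hS x hx =>
    mt (hST x hx).2 (hS x hx)
  rw [Set.ofPred_and, real_inter_of_determinedBy d1 d2 hCD]
  simp only [Set.mem_ofPred_eq] at e1 e2
  rw [e1, e2, Finset.prod_congr rfl fun x hx => real_setOf_mem (hC x hx),
    Finset.prod_congr rfl fun x hx => real_setOf_notMem (hD x hx), Finset.prod_const,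
    Finset.prod_const]

open scoped Classical in
/-- The probability that a random set contains `C`, misses `D`, and satisfies further conditions
depending on pairwise disjoint blocks. -/
theorem real_subset_disjoint_forall {C D : Finset X} (hC : ∀ x ∈ C, x ∈ u) (hD : ∀ x ∈ D, x ∈ u)
    (hCD : Disjoint C D) (K : Finset ι) (A : ι → Set (Set X)) (F : ι → Finset X)
    (hA : ∀ i ∈ K, DeterminedBy (A i) (F i))
    (hF : ∀ i ∈ K, ∀ j ∈ K, i ≠ j → Disjoint (F i) (F j))
    (hCF : ∀ i ∈ K, Disjoint C (F i)) (hDF : ∀ i ∈ K, Disjoint D (F i)) (r : ℝ)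
    (hr : ∀ i ∈ K, (setBernoulli u p).real (A i) = r) :
    (setBernoulli u p).real
        {S | ((∀ x ∈ C, x ∈ S) ∧ ∀ x ∈ D, x ∉ S) ∧ ∀ i ∈ K, S ∈ A i} =
      (p : ℝ) ^ C.card * (1 - p : ℝ) ^ D.card * r ^ K.card := by
  have d1 : DeterminedBy {S : Set X | (∀ x ∈ C, x ∈ S) ∧ ∀ x ∈ D, x ∉ S} (C ∪ D) :=
    fun S T hST hS => ⟨fun x hx => (hST x (Finset.mem_union_left _ hx)).1 (hS.1 x hx),
      fun x hx => mt (hST x (Finset.mem_union_right _ hx)).2 (hS.2 x hx)⟩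
  have d2 : DeterminedBy {S | ∀ i ∈ K, S ∈ A i} (K.biUnion F) := by
    intro S T hST hS i hi
    exact hA i hi S T (fun x hx => hST x (Finset.mem_biUnion.2 ⟨i, hi, hx⟩)) (hS i hi)
  have hdis : Disjoint (C ∪ D) (K.biUnion F) :=
    (Finset.disjoint_biUnion_right _ _ _).2 fun i hi =>
      Finset.disjoint_union_left.2 ⟨hCF i hi, hDF i hi⟩
  rw [Set.ofPred_and, real_inter_of_determinedBy d1 d2 hdis, real_subset_and_disjoint hC hD hCD,
    real_forall_of_determinedBy K A F hA hF, Finset.prod_congr rfl hr, Finset.prod_const]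

open scoped Classical in
/-- The probability that the trace of a random set on an injective finite family lies in a given
set of patterns. -/
theorem real_preimage_mem {k : ℕ} (e : Fin k → X) (he : Function.Injective e)
    (hu : ∀ i, e i ∈ u) (T : Finset (Finset (Fin k))) :
    (setBernoulli u p).real {S | ∃ t ∈ T, ∀ i, e i ∈ S ↔ i ∈ t} =
      ∑ l : Fin (k + 1), ((T.filter fun t => t.card = (l : ℕ)).card : ℝ) *
        (p : ℝ) ^ (l : ℕ) * (1 - p : ℝ) ^ (k - (l : ℕ)) := by
  have hset : {S : Set X | ∃ t ∈ T, ∀ i, e i ∈ S ↔ i ∈ t} =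
      ⋃ t ∈ T, {S | (∀ x ∈ t.image e, x ∈ S) ∧ ∀ x ∈ tᶜ.image e, x ∉ S} := by
    ext S
    simp only [Set.mem_ofPred_eq, Set.mem_iUnion, exists_prop, Finset.forall_mem_image,
      Finset.mem_compl]
    refine exists_congr fun t => and_congr_right fun _ => ?_
    exact ⟨fun h => ⟨fun i hi => (h i).2 hi, fun i hi => mt (h i).1 hi⟩,
      fun h i => ⟨fun hi => by_contra fun h' => h.2 h' hi, fun hi => h.1 hi⟩⟩
  rw [hset, measureReal_biUnion_finset]
  · have hw : ∀ t ∈ T, (setBernoulli u p).real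
        {S | (∀ x ∈ t.image e, x ∈ S) ∧ ∀ x ∈ tᶜ.image e, x ∉ S} =
        (p : ℝ) ^ t.card * (1 - p : ℝ) ^ (k - t.card) := fun t _ => by
      rw [real_subset_and_disjoint, Finset.card_image_of_injective _ he,
        Finset.card_image_of_injective _ he, Finset.card_compl, Fintype.card_fin]
      · simp [hu]
      · simp [hu]
      · exact (Finset.disjoint_image he).2 disjoint_compl_right
    -- The patterns are mutually exclusive, and the probability of a pattern depends only on its
    -- size, so they are grouped by cardinality.
    rw [Finset.sum_congr rfl hw, Finset.sum_fin_eq_sum_range,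
      ← Finset.sum_fiberwise_of_maps_to (s := T) (t := Finset.range (k + 1)) (g := Finset.card)]
    · refine Finset.sum_congr rfl fun l hl => ?_
      rw [dif_pos (Finset.mem_range.1 hl)]
      rw [Finset.sum_congr rfl (g := fun _ => (p : ℝ) ^ l * (1 - p : ℝ) ^ (k - l)),
        Finset.sum_const, nsmul_eq_mul, mul_assoc]
      intro t ht
      rw [(Finset.mem_filter.1 ht).2]
    · intro t _
      exact Finset.mem_range.2 (Nat.lt_succ_of_le (card_finset_fin_le t))
  · intro t _ t' _ htt'
    refine Set.disjoint_left.2 fun S hS hS' => htt' ?_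
    simp only [Set.mem_ofPred_eq, Finset.forall_mem_image, Finset.mem_compl] at hS hS'
    ext i
    exact ⟨fun hi => by_contra fun h => hS'.2 h (hS.1 hi),
      fun hi => by_contra fun h => hS.2 h (hS'.1 hi)⟩
  · exact fun _ _ => (Set.toFinite _).measurableSet

end RandomSets

/-! ### Probabilities of the bad configurations -/

/-- The sets of edges between a path of the `m`-th orientation and a further vertex which contain
a witness. -/
def centrePatterns (m : Fin 4) : Finset (Finset (Fin 8)) :=
  Finset.univ.filter fun t => ∃ w ∈ centreWitnesses m, ∀ j ∈ w, j ∈ t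

/-- The matrix is obtained by enumerating, for each orientation, the 256 subsets of the eight
possible edges at κ. -/
theorem card_centrePatterns (m : Fin 4) (l : Fin 9) :
    ((centrePatterns m).filter fun t => t.card = (l : ℕ)).card =
      ![![0, 0, 0, 2, 11, 22, 23, 8, 1],
        ![0, 0, 0, 4, 19, 33, 25, 8, 1],
        ![0, 0, 0, 4, 19, 33, 25, 8, 1],
        ![0, 0, 0, 2, 16, 34, 26, 8, 1]] m l := by
  revert m l
  decide +kernel

theorem centreCount_eq_card (m : Fin 4) (l : Fin 9) :
    centreCount m l = (((centrePatterns m).filter fun t => t.card = (l : ℕ)).card : ℝ) := by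
  rw [card_centrePatterns]
  fin_cases m <;> fin_cases l <;> simp [centreCount]

section Probability

variable {n : ℕ} {p : unitInterval}

/-- The probability that a random edge set contains `C` and that no vertex outside `s` is a common
in-neighbour or a common out-neighbour of the vertices in `s`. -/
theorem real_subset_and_no_cone (s : Finset (Fin n)) (C : Finset (Fin n × Fin n))
    (hC : ∀ e ∈ C, e.1 ≠ e.2 ∧ e.1 ∈ s ∧ e.2 ∈ s) :
    (setBernoulli (possibleEdges n) p).real
        {S | (∀ e ∈ C, e ∈ S) ∧ ∀ κ, κ ∉ s →
          ¬(∀ x ∈ s, (κ, x) ∈ S) ∧ ¬∀ x ∈ s, (x, κ) ∈ S} =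
      (p : ℝ) ^ C.card * (1 - (p : ℝ) ^ s.card) ^ (2 * (n - s.card)) := by
  -- One block for each outside vertex and each direction, giving 2(n - |s|) blocks; the condition
  -- on a block fails exactly when all its |s| edges are present.
  let F : Fin n × Bool → Finset (Fin n × Fin n) := fun i =>
    s.image fun x => if i.2 then (i.1, x) else (x, i.1)
  have hFcard : ∀ i, (F i).card = s.card := fun ⟨κ, b⟩ =>
    Finset.card_image_of_injective _ fun x y h => by cases b <;> simpa using h
  have hFu : ∀ i ∈ sᶜ ×ˢ (Finset.univ : Finset Bool), ∀ e ∈ F i, e ∈ possibleEdges n := by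
    rintro ⟨κ, b⟩ hi e he
    have hκ : κ ∉ s := by simpa using hi
    obtain ⟨x, hx, rfl⟩ := Finset.mem_image.1 he
    have hne : κ ≠ x := fun h => hκ (h ▸ hx)
    cases b
    · simpa [possibleEdges] using hne.symm
    · simpa [possibleEdges] using hne
  have h := real_subset_disjoint_forall (u := possibleEdges n) (p := p) (C := C) (D := ∅)
    (fun e he => (hC e he).1) (by simp) (by simp) (sᶜ ×ˢ (Finset.univ : Finset Bool))
    (fun i => {S | ¬∀ e ∈ F i, e ∈ S}) F
    (fun i _ S T hST hS hT => hS fun e he => (hST e he).2 (hT e he)) ?_ ?_ (by simp)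
    (1 - (p : ℝ) ^ s.card) ?_
  · rw [Finset.card_empty, pow_zero, mul_one, Finset.card_product, Finset.card_compl,
      Finset.card_univ, Fintype.card_bool, Fintype.card_fin, mul_comm _ 2] at h
    rw [← h]
    congr 1
    ext S
    simp only [Set.mem_ofPred_eq, Finset.notMem_empty, false_imp_iff, imp_true_iff, and_true,
      Finset.mem_product, Finset.mem_compl, Finset.mem_univ, Prod.forall, Bool.forall_bool, F,
      Finset.forall_mem_image, Bool.false_eq_true, if_true, if_false]
    exact and_congr_right fun _ => ⟨fun h κ => ⟨fun hκ => (h κ hκ).2, fun hκ => (h κ hκ).1⟩,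
      fun h κ hκ => ⟨(h κ).2 hκ, (h κ).1 hκ⟩⟩
  · rintro ⟨κ, b⟩ hi ⟨κ', b'⟩ hj hij
    have hκ : κ ∉ s := by simpa using hi
    have hκ' : κ' ∉ s := by simpa using hj
    refine Finset.disjoint_left.2 fun e he he' => ?_
    obtain ⟨x, hx, rfl⟩ := Finset.mem_image.1 he
    obtain ⟨y, hy, hxy⟩ := Finset.mem_image.1 he'
    cases b <;> cases b' <;> simp at hxy hij <;> grind
  · rintro ⟨κ, b⟩ hi
    have hκ : κ ∉ s := by simpa using hi
    refine Finset.disjoint_left.2 fun e he he' => ?_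
    obtain ⟨x, hx, rfl⟩ := Finset.mem_image.1 he'
    have := hC _ he
    cases b <;> simp at this <;> exact hκ (by tauto)
  · intro i hi
    have h1 := real_subset_and_disjoint (u := possibleEdges n) (p := p) (C := F i) (D := ∅)
      (hFu i hi) (by simp) (by simp)
    have h2 := probReal_compl_eq_one_sub (μ := setBernoulli (possibleEdges n) p)
      (s := {S | ∀ e ∈ F i, e ∈ S}) (Set.toFinite _).measurableSet
    simp only [Finset.notMem_empty, false_imp_iff, imp_true_iff, and_true, Finset.card_empty,
      pow_zero, mul_one, hFcard] at h1
    rw [h1] at h2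
    exact h2

theorem real_isBadPair {a b : Fin n} (hab : a ≠ b) :
    (setBernoulli (possibleEdges n) p).real {S | IsBadPair (ofEdgeSet S) a b} =
      (p : ℝ) ^ 2 * (1 - (p : ℝ) ^ 2) ^ (2 * n - 4) := by
  have h := real_subset_and_no_cone (p := p) {a, b} {(a, b), (b, a)} (by simp [hab, hab.symm])
  have hC : ({(a, b), (b, a)} : Finset (Fin n × Fin n)).card = 2 :=
    Finset.card_pair (by simp [hab])
  rw [hC, Finset.card_pair hab, Nat.mul_sub] at h
  rw [← h]
  congr 1
  ext S
  simp [IsBadPair, ofEdgeSet]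

theorem real_isBadTriangle {a b c : Fin n} (hab : a ≠ b) (hac : a ≠ c) (hbc : b ≠ c) :
    (setBernoulli (possibleEdges n) p).real {S | IsBadTriangle (ofEdgeSet S) a b c} =
      (p : ℝ) ^ 3 * (1 - (p : ℝ) ^ 3) ^ (2 * n - 6) := by
  have h := real_subset_and_no_cone (p := p) {a, b, c} {(a, b), (b, c), (c, a)}
    (by simp [hab, hbc, hac.symm])
  have hC : ({(a, b), (b, c), (c, a)} : Finset (Fin n × Fin n)).card = 3 :=
    Finset.card_eq_three.2 ⟨_, _, _, by simp [hab], by simp [hac], by simp [hbc], rfl⟩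
  rw [hC, Finset.card_eq_three.2 ⟨a, b, c, hab, hac, hbc, rfl⟩, Nat.mul_sub] at h
  rw [← h]
  congr 1
  ext S
  simp [IsBadTriangle, ofEdgeSet]

theorem centreEdge_injective {v : Fin 4 → Fin n} (hv : Function.Injective v) {κ : Fin n}
    (hκ : ∀ i, v i ≠ κ) : Function.Injective (centreEdge v κ) := by
  intro i j h
  have := fun i j => hv.eq_iff (a := i) (b := j)
  have hκ' := fun i => (hκ i).symm
  fin_cases i <;> fin_cases j <;> simp [centreEdge, hκ, hκ', this] at h ⊢

theorem eq_or_eq_of_mem_centreEdge (v : Fin 4 → Fin n) (κ : Fin n) (j : Fin 8) :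
    ∃ i, centreEdge v κ j = (v i, κ) ∨ centreEdge v κ j = (κ, v i) := by
  fin_cases j
  exacts [⟨0, .inl rfl⟩, ⟨1, .inl rfl⟩, ⟨2, .inl rfl⟩, ⟨3, .inl rfl⟩, ⟨0, .inr rfl⟩,
    ⟨1, .inr rfl⟩, ⟨2, .inr rfl⟩, ⟨3, .inr rfl⟩]

theorem real_isBadPath (m : Fin 4) {v : Fin 4 → Fin n} (hv : Function.Injective v) :
    (setBernoulli (possibleEdges n) p).real {S | IsBadPath (ofEdgeSet S) m v} =
      (p : ℝ) ^ 3 * (1 - (p : ℝ)) ^ shortcutCount m *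
        (1 - ∑ l : Fin 9, centreCount m l * (p : ℝ) ^ (l : ℕ) *
          (1 - (p : ℝ)) ^ (8 - (l : ℕ))) ^ (n - 4) := by
  have hvv : Function.Injective (Prod.map v v) := hv.prodMap hv
  let F : Fin n → Finset (Fin n × Fin n) := fun κ => Finset.univ.image (centreEdge v κ)
  let K : Finset (Fin n) := (Finset.univ.image v)ᶜ
  have hK : ∀ {κ}, κ ∈ K ↔ ∀ i, v i ≠ κ := by simp [K]
  have hcard1 : ∀ m, (pathEdges m).card = 3 := by decide
  have hcard2 : ∀ m, (shortcutEdges m).card = shortcutCount m := by decide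
  have hne1 : ∀ m, ∀ e ∈ pathEdges m, e.1 ≠ e.2 := by decide
  have hne2 : ∀ m, ∀ e ∈ shortcutEdges m, e.1 ≠ e.2 := by decide
  have hdisj : ∀ m, Disjoint (pathEdges m) (shortcutEdges m) := by decide
  -- Path and shortcut edges have both ends among the `v i`, whereas every edge of a block has the
  -- end κ.
  have hF : ∀ (E : Finset (Fin 4 × Fin 4)), ∀ κ ∈ K, Disjoint (E.image (Prod.map v v)) (F κ) := by
    intro E κ hκ
    refine Finset.disjoint_left.2 fun e he he' => ?_
    obtain ⟨x, -, rfl⟩ := Finset.mem_image.1 he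
    obtain ⟨j, -, hj⟩ := Finset.mem_image.1 he'
    obtain ⟨i, h | h⟩ := eq_or_eq_of_mem_centreEdge v κ j
    · exact hK.1 hκ x.2 (congrArg Prod.snd (hj.symm.trans h))
    · exact hK.1 hκ x.1 (congrArg Prod.fst (hj.symm.trans h))
  have h := real_subset_disjoint_forall (u := possibleEdges n) (p := p)
    (C := (pathEdges m).image (Prod.map v v)) (D := (shortcutEdges m).image (Prod.map v v))
    ?_ ?_ ((Finset.disjoint_image hvv).2 (hdisj m)) K
    (fun κ => {S | ∀ w ∈ centreWitnesses m, ∃ j ∈ w, centreEdge v κ j ∉ S}) F ?_ ?_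
    (hF _) (hF _) (1 - ∑ l : Fin 9, centreCount m l * (p : ℝ) ^ (l : ℕ) *
          (1 - (p : ℝ)) ^ (8 - (l : ℕ))) ?_
  · rw [Finset.card_image_of_injective _ hvv, Finset.card_image_of_injective _ hvv, hcard1, hcard2,
      Finset.card_compl, Finset.card_image_of_injective _ hv, Finset.card_univ, Fintype.card_fin,
      Fintype.card_fin] at h
    rw [← h]
    congr 1
    ext S
    simp only [Finset.forall_mem_image, Set.mem_ofPred_eq, hK]
    rfl
  · intro e he
    obtain ⟨x, hx, rfl⟩ := Finset.mem_image.1 he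
    exact hv.ne (hne1 m x hx)
  · intro e he
    obtain ⟨x, hx, rfl⟩ := Finset.mem_image.1 he
    exact hv.ne (hne2 m x hx)
  · intro κ _ S T hST hS w hw
    obtain ⟨j, hj, hjS⟩ := hS w hw
    exact ⟨j, hj, mt (hST _ (Finset.mem_image_of_mem _ (Finset.mem_univ j))).2 hjS⟩
  · intro κ hκ κ' hκ' hne
    refine Finset.disjoint_left.2 fun e he he' => ?_
    obtain ⟨i, -, rfl⟩ := Finset.mem_image.1 he
    obtain ⟨j, -, hj⟩ := Finset.mem_image.1 he'
    obtain ⟨i', h | h⟩ := eq_or_eq_of_mem_centreEdge v κ i <;>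
    obtain ⟨j', h' | h'⟩ := eq_or_eq_of_mem_centreEdge v κ' j <;>
    rw [h, h', Prod.mk.injEq] at hj
    · exact hne hj.2.symm
    · exact hK.1 hκ' i' hj.1.symm
    · exact hK.1 hκ j' hj.1
    · exact hne hj.1.symm
  · intro κ hκ
    have hκ := hK.1 hκ
    have h1 := real_preimage_mem (u := possibleEdges n) (p := p) (centreEdge v κ)
      (centreEdge_injective hv hκ) (fun j => by
        obtain ⟨i, h | h⟩ := eq_or_eq_of_mem_centreEdge v κ j <;> rw [h]
        · exact hκ i
        · exact (hκ i).symm) (centrePatterns m)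
    -- Having no witness at κ is the complement of the event that the edges at κ form one of the
    -- patterns counted by `centreCount`.
    have h2 := probReal_compl_eq_one_sub (μ := setBernoulli (possibleEdges n) p)
      (s := {S | ∃ t ∈ centrePatterns m, ∀ i, centreEdge v κ i ∈ S ↔ i ∈ t})
      (Set.toFinite _).measurableSet
    simp only [← centreCount_eq_card] at h1
    rw [h1] at h2
    rw [← h2]
    congr 1
    ext S
    classical
    simp only [Set.mem_ofPred_eq, Set.mem_compl_iff, centrePatterns, Finset.mem_filter,
      Finset.mem_univ, true_and, not_exists, not_and]
    constructor
    · rintro hS t ⟨w, hw, hwt⟩ ht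
      obtain ⟨j, hj, hjS⟩ := hS w hw
      exact hjS ((ht j).2 (hwt j hj))
    · intro hS w hw
      by_contra! hn
      exact hS (Finset.univ.filter fun j => centreEdge v κ j ∈ S) ⟨w, hw, by simpa using hn⟩
        (by simp)

/-! ### Union bounds over the positions of bad configurations -/

theorem IsBadPair.symm {V : Type*} {G : Digraph V} {a b : V} (h : IsBadPair G a b) :
    IsBadPair G b a :=
  ⟨h.1.symm, fun κ hb ha => ⟨fun h' => (h.2 κ ha hb).1 h'.symm, fun h' => (h.2 κ ha hb).2 h'.symm⟩⟩

theorem IsBadTriangle.rotate {V : Type*} {G : Digraph V} {a b c : V} (h : IsBadTriangle G a b c) :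
    IsBadTriangle G b c a :=
  ⟨⟨h.1.2.1, h.1.2.2, h.1.1⟩, fun κ hb hc ha =>
    ⟨fun h' => (h.2 κ ha hb hc).1 ⟨h'.2.2, h'.1, h'.2.1⟩,
      fun h' => (h.2 κ ha hb hc).2 ⟨h'.2.2, h'.1, h'.2.1⟩⟩⟩

theorem real_biUnion_le {X α : Type*} [MeasurableSpace X] (μ : Measure X) [IsFiniteMeasure μ]
    (s : Finset α) (E : α → Set X) (r : ℝ) (h : ∀ i ∈ s, μ.real (E i) ≤ r) :
    μ.real (⋃ i ∈ s, E i) ≤ s.card * r :=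
  (measureReal_biUnion_finset_le s E).trans <|
    (Finset.sum_le_sum h).trans_eq (by rw [Finset.sum_const, nsmul_eq_mul])

/-- Badness is symmetric in the two vertices, so one event per unordered pair suffices. -/
theorem real_exists_isBadPair_le :
    (setBernoulli (possibleEdges n) p).real
        {S | ∃ a b, a ≠ b ∧ IsBadPair (ofEdgeSet S) a b} ≤
      (n.choose 2 : ℝ) * ((p : ℝ) ^ 2 * (1 - (p : ℝ) ^ 2) ^ (2 * n - 4)) := by
  let E : Finset (Fin n) → Set (Set (Fin n × Fin n)) := fun s =>
    {S | ∃ a b, a ≠ b ∧ s = {a, b} ∧ IsBadPair (ofEdgeSet S) a b}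
  have h := real_biUnion_le (setBernoulli (possibleEdges n) p)
    (Finset.univ.powersetCard 2) E ((p : ℝ) ^ 2 * (1 - (p : ℝ) ^ 2) ^ (2 * n - 4)) ?_
  · rw [Finset.card_powersetCard, Finset.card_univ, Fintype.card_fin] at h
    refine (measureReal_mono ?_ (measure_ne_top _ _)).trans h
    rintro S ⟨a, b, hab, hS⟩
    refine Set.mem_biUnion (x := {a, b}) ?_ ⟨a, b, hab, rfl, hS⟩
    exact Finset.mem_powersetCard.2 ⟨Finset.subset_univ _, Finset.card_pair hab⟩
  · intro s hs
    obtain ⟨x, y, hxy, rfl⟩ := Finset.card_eq_two.1 (Finset.mem_powersetCard.1 hs).2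
    rw [← real_isBadPair hxy]
    refine measureReal_mono ?_
    rintro S ⟨a, b, hab, hs, hS⟩
    have ha : a = x ∨ a = y := by
      have : a ∈ ({x, y} : Finset (Fin n)) := by rw [hs]; simp
      simpa using this
    have hb : b = x ∨ b = y := by
      have : b ∈ ({x, y} : Finset (Fin n)) := by rw [hs]; simp
      simpa using this
    rcases ha with rfl | rfl <;> rcases hb with rfl | rfl
    · exact absurd rfl hab
    · exact hS
    · exact hS.symm
    · exact absurd rfl hab

/-- Badness is invariant under rotation, so each 3-set carries two events, one for each cyclic
orientation; this is the factor 2. -/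
theorem real_exists_isBadTriangle_le :
    (setBernoulli (possibleEdges n) p).real
        {S | ∃ a b c, a ≠ b ∧ a ≠ c ∧ b ≠ c ∧ IsBadTriangle (ofEdgeSet S) a b c} ≤
      (n.choose 3 : ℝ) * (2 * ((p : ℝ) ^ 3 * (1 - (p : ℝ) ^ 3) ^ (2 * n - 6))) := by
  let E : Finset (Fin n) → Set (Set (Fin n × Fin n)) := fun s =>
    {S | ∃ a b c, a ≠ b ∧ a ≠ c ∧ b ≠ c ∧ s = {a, b, c} ∧ IsBadTriangle (ofEdgeSet S) a b c}
  have h := real_biUnion_le (setBernoulli (possibleEdges n) p)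
    (Finset.univ.powersetCard 3) E (2 * ((p : ℝ) ^ 3 * (1 - (p : ℝ) ^ 3) ^ (2 * n - 6))) ?_
  · rw [Finset.card_powersetCard, Finset.card_univ, Fintype.card_fin] at h
    refine (measureReal_mono ?_ (measure_ne_top _ _)).trans h
    rintro S ⟨a, b, c, hab, hac, hbc, hS⟩
    refine Set.mem_biUnion (x := {a, b, c}) ?_ ⟨a, b, c, hab, hac, hbc, rfl, hS⟩
    exact Finset.mem_powersetCard.2 ⟨Finset.subset_univ _,
      Finset.card_eq_three.2 ⟨a, b, c, hab, hac, hbc, rfl⟩⟩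
  · intro s hs
    obtain ⟨x, y, z, hxy, hxz, hyz, rfl⟩ :=
      Finset.card_eq_three.1 (Finset.mem_powersetCard.1 hs).2
    rw [two_mul]
    -- This turns both summands into the probability for x, y, z; the next line moves the second one
    -- to the opposite orientation x, z, y.
    conv_rhs => rw [← real_isBadTriangle hxy hxz hyz]
    conv_rhs => arg 2; rw [real_isBadTriangle hxy hxz hyz, ← real_isBadTriangle hxz hxy hyz.symm]
    refine (measureReal_mono ?_).trans (measureReal_union_le _ _)
    rintro S ⟨a, b, c, hab, hac, hbc, hs, hS⟩
    have hmem : ∀ w, w ∈ ({a, b, c} : Finset (Fin n)) → w = x ∨ w = y ∨ w = z := by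
      intro w hw
      rw [← hs] at hw
      simpa using hw
    rcases hmem a (by simp) with rfl | rfl | rfl <;>
    rcases hmem b (by simp) with rfl | rfl | rfl <;>
    rcases hmem c (by simp) with rfl | rfl | rfl <;>
    first
    | exact absurd rfl hab
    | exact absurd rfl hac
    | exact absurd rfl hbc
    | exact .inl hS
    | exact .inl hS.rotate
    | exact .inl hS.rotate.rotate
    | exact .inr hS
    | exact .inr hS.rotate
    | exact .inr hS.rotate.rotate

/-- For each orientation class the events are indexed by the injections of four points into the
vertices, 4! times `n.choose 4` of them. No symmetry factor arises, since no orientation is fixed by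
reversal. -/
theorem real_exists_isBadPath_le :
    (setBernoulli (possibleEdges n) p).real
        {S | ∃ m v, Function.Injective v ∧ IsBadPath (ofEdgeSet S) m v} ≤
      (n.choose 4 : ℝ) * (Nat.factorial 4 : ℝ) *
        ∑ m : Fin 4, (p : ℝ) ^ 3 * (1 - (p : ℝ)) ^ shortcutCount m *
          (1 - ∑ l : Fin 9, centreCount m l * (p : ℝ) ^ (l : ℕ) *
            (1 - (p : ℝ)) ^ (8 - (l : ℕ))) ^ (n - 4) := by
  rw [Finset.mul_sum]
  have hset : {S | ∃ m v, Function.Injective v ∧ IsBadPath (ofEdgeSet S) m v} ⊆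
      ⋃ m ∈ (Finset.univ : Finset (Fin 4)), ⋃ v ∈ (Finset.univ : Finset (Fin 4 ↪ Fin n)),
        {S | IsBadPath (ofEdgeSet S) m v} := by
    rintro S ⟨m, v, hv, hS⟩
    simp only [Finset.mem_univ, Set.iUnion_true, Set.mem_iUnion]
    exact ⟨m, ⟨v, hv⟩, hS⟩
  refine (measureReal_mono hset (measure_ne_top _ _)).trans
    ((measureReal_biUnion_finset_le _ _).trans ?_)
  refine Finset.sum_le_sum fun m _ => ?_
  refine (real_biUnion_le _ _ _ _ fun v _ => (real_isBadPath m v.injective).le).trans_eq ?_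
  rw [Finset.card_univ, Fintype.card_embedding_eq, Fintype.card_fin, Fintype.card_fin,
    Nat.descFactorial_eq_factorial_mul_choose, Nat.cast_mul, mul_comm (Nat.factorial 4 : ℝ)]

end Probability

end PathHomology

end

theorem mainTheorem6 (n : ℕ) (p : unitInterval) :
    (PathHomology.randomDigraph n p).real {G | 0 < PathHomology.betti ℤ G 1} ≤
      (n.choose 4 : ℝ) * (Nat.factorial 4 : ℝ) *
          ∑ m : Fin 4, (p : ℝ) ^ 3 * (1 - (p : ℝ)) ^ PathHomology.shortcutCount m *
            (1 - ∑ l : Fin 9, PathHomology.centreCount m l *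
              (p : ℝ) ^ (l : ℕ) * (1 - (p : ℝ)) ^ (8 - (l : ℕ))) ^ (n - 4)
        + (n.choose 2 : ℝ) * (p : ℝ) ^ 2 * (1 - (p : ℝ) ^ 2) ^ (2 * n - 4)
        + 2 * (n.choose 3 : ℝ) * (p : ℝ) ^ 3 * (1 - (p : ℝ) ^ 3) ^ (2 * n - 6) := by
  open PathHomology in
  -- Edge sets containing a loop form a null event; off it the graph is loop-free, so the vertices
  -- of bad pairs and triangles are automatically distinct.
  have h0 : (setBernoulli (possibleEdges n) p).real {S | ¬S ⊆ possibleEdges n} = 0 := by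
    rw [measureReal_def, ae_iff.1 setBernoulli_ae_subset, ENNReal.toReal_zero]
  have h4 := real_exists_isBadPath_le (n := n) (p := p)
  have h2 := real_exists_isBadPair_le (n := n) (p := p)
  have h3 := real_exists_isBadTriangle_le (n := n) (p := p)
  rw [randomDigraph, map_measureReal_apply (measurable_ofEdgeSet n) trivial]
  refine (measureReal_mono (s₂ := (({S | ∃ m v, Function.Injective v ∧
      IsBadPath (ofEdgeSet S) m v} ∪ {S | ∃ a b, a ≠ b ∧ IsBadPair (ofEdgeSet S) a b}) ∪
      {S | ∃ a b c, a ≠ b ∧ a ≠ c ∧ b ≠ c ∧ IsBadTriangle (ofEdgeSet S) a b c}) ∪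
      {S | ¬S ⊆ possibleEdges n}) ?_).trans ?_
  · intro S hS
    by_contra hn
    simp only [Set.mem_union, Set.mem_ofPred_eq, not_or, not_exists, not_and, not_not] at hn
    obtain ⟨⟨⟨n4, n2⟩, n3⟩, hSu⟩ := hn
    have h1 : ∀ a, ¬(ofEdgeSet S).Adj a a := fun a ha => hSu ha rfl
    have hne : ∀ {a b}, (ofEdgeSet S).Adj a b → a ≠ b := fun h => hSu h
    refine (Nat.pos_iff_ne_zero.1 hS) (betti_eq_zero h1 (fun a b h => n2 a b (hne h.1.1) h)
      (fun a b c h => n3 a b c (hne h.1.1) (hne h.1.2.2).symm (hne h.1.2.1) h) n4)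
  · refine (measureReal_union_le _ _).trans ?_
    refine (add_le_add (measureReal_union_le _ _) h0.le).trans ?_
    rw [add_zero]
    refine (add_le_add ((measureReal_union_le _ _).trans (add_le_add h4 h2)) h3).trans_eq ?_
    ring
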